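/- Let $r\ge 1$ and let $e_1,\dots,e_{r+1}$ be the standard basis of $\mathbb{R}^{r+1}$ with its standard inner product. Consider the root system of type $A_r$ (that of $\mathfrak{sl}_{r+1}(\mathbb{C})$), with simple roots $\alpha_k=e_k-e_{k+1}$ for $1\le k\le r$, positive roots $\Phi^+=\{\alpha_i+\alpha_{i+1}+\cdots+\alpha_j : 1\le i\le j\le r\}$, highest root $\tilde\alpha=\alpha_1+\cdots+\alpha_r$, and $\rho=\frac12\sum_{\alpha\in\Phi^+}\alpha$. Let $W$ be the Weyl group, generated by the orthogonal reflections $s_k$ in the hyperplanes $\alpha_k^{\perp}$, $1\le k\le r$. Let $\wp(\xi)$ (Kostant's partition function) be the number of ways to write $\xi$ as a linear combination of the positive roots with nonnegative integer coefficients, and let $$\mathcal{A}_r(\lambda,\mu)=\{\sigma\in W : \wp(\sigma(\lambda+\rho)-\mu-\rho)>0\}$$ be the Weyl alternation set. Let $F_n$ be the Fibonacci numbers, $F_0=0$, $F_1=1$, $F_n=F_{n-1}+F_{n-2}$, where the recurrence is also used to extend them to negative indices (so $F_{-1}=1$). 1. If $r\ge 2$ and $i=1$ or $i=r-1$, then $$|\mathcal{A}_r(\tilde\alpha,-\alpha_i-\alpha_{i+1})|=F_{r+1}+F_{r-3}=3F_{r-1}.$$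 2. If $r\ge 4$ and $2\le i\le r-2$, then $$|\mathcal{A}_r(\tilde\alpha,-\alpha_i-\alpha_{i+1})|=F_r+F_{i-2}F_{r-i}+3F_{i-1}F_{r-i-1}+F_iF_{r-i-2}.$$ -/

import Mathlib

namespace TypeA

/-- The Euclidean space `ℝ^{r+1}` that carries the root system of type `A_r`, i.e. that of
`𝔰𝔩_{r+1}(ℂ)`. -/
abbrev V (r : ℕ) : Type := EuclideanSpace ℝ (Fin (r + 1))

/-- The standard basis vector `e_k` of `ℝ^{r+1}`, for `1 ≤ k ≤ r + 1` (indices start at `1`; the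
value is `0` for the unused indices `k` outside this range). -/
noncomputable def e (r k : ℕ) : V r := WithLp.toLp 2 fun j => if (j : ℕ) + 1 = k then 1 else 0

/-- The simple root `α_k = e_k - e_{k+1}`, for `1 ≤ k ≤ r`. -/
noncomputable def simpleRoot (r k : ℕ) : V r := e r k - e r (k + 1)

/-- `α_{i,j} = α_i + α_{i+1} + ⋯ + α_j`, for `1 ≤ i ≤ j ≤ r`. -/
noncomputable def rootSum (r i j : ℕ) : V r := ∑ k ∈ Finset.Icc i j, simpleRoot r k

open Classical in
/-- The set `Φ⁺ = {α_{i,j} : 1 ≤ i ≤ j ≤ r}` of positive roots. -/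
noncomputable def positiveRoots (r : ℕ) : Finset (V r) :=
  ((Finset.Icc 1 r ×ˢ Finset.Icc 1 r).filter fun p => p.1 ≤ p.2).image
    fun p => rootSum r p.1 p.2

/-- The highest root `α₁ + α₂ + ⋯ + α_r`. -/
noncomputable def highestRoot (r : ℕ) : V r := rootSum r 1 r

/-- `ρ`, half the sum of the positive roots. -/
noncomputable def rho (r : ℕ) : V r := (1 / 2 : ℝ) • ∑ β ∈ positiveRoots r, β

/-- The simple reflection `s_k`: the orthogonal reflection of `ℝ^{r+1}` in the hyperplane
orthogonal to `α_k`, for `1 ≤ k ≤ r`. -/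
noncomputable def simpleReflection (r k : ℕ) : V r ≃ₗᵢ[ℝ] V r :=
  (Submodule.span ℝ {simpleRoot r k})ᗮ.reflection

/-- The Weyl group `W` of type `A_r`, generated by the simple reflections `s_1, …, s_r`. -/
noncomputable def weylGroup (r : ℕ) : Subgroup (V r ≃ₗᵢ[ℝ] V r) :=
  Subgroup.closure {s | ∃ k, 1 ≤ k ∧ k ≤ r ∧ s = simpleReflection r k}

/-- The height functional: it sends every simple root `α_k`, `1 ≤ k ≤ r`, to `1`. -/
theorem height_simpleRoot (r k : ℕ) (hk : 1 ≤ k) (hkr : k ≤ r) :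
    ∑ j : Fin (r + 1), -(j : ℝ) * simpleRoot r k j = 1 := by
  obtain ⟨m, rfl⟩ : ∃ m, k = m + 1 := ⟨k - 1, by omega⟩
  have h1 : ∀ n, n ≤ r → ∑ j : Fin (r + 1), -(j : ℝ) * e r (n + 1) j = -(n : ℝ) := by
    intro n hn
    rw [Finset.sum_eq_single (⟨n, by omega⟩ : Fin (r + 1))]
    · simp [e]
    · intro b _ hb
      have : (b : ℕ) ≠ n := fun h => hb (Fin.ext h)
      simp [e, this]
    · simp
  simp only [simpleRoot, PiLp.sub_apply, mul_sub, Finset.sum_sub_distrib]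
  rw [h1 m (by omega), h1 (m + 1) hkr]
  push_cast
  ring

/-- Every positive root has height at least `1`. -/
theorem one_le_height (r : ℕ) (β : V r) (hβ : β ∈ positiveRoots r) :
    1 ≤ ∑ j : Fin (r + 1), -(j : ℝ) * β j := by
  classical
  simp only [positiveRoots, Finset.mem_image, Finset.mem_filter, Finset.mem_product,
    Finset.mem_Icc] at hβ
  obtain ⟨⟨a, b⟩, ⟨⟨⟨ha, _⟩, ⟨_, hb⟩⟩, hab⟩, rfl⟩ := hβ
  simp only [rootSum, WithLp.ofLp_sum, Finset.sum_apply, Finset.mul_sum]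
  rw [Finset.sum_comm, Finset.sum_congr rfl (g := fun _ => (1 : ℝ))]
  · simp only [Finset.sum_const, Nat.card_Icc, nsmul_eq_mul, mul_one]
    have : 1 ≤ b + 1 - a := by simp only at hab; omega
    exact_mod_cast this
  · intro k hk
    rw [Finset.mem_Icc] at hk
    exact height_simpleRoot r k (by simp only at ha; omega) (by simp only at hb; omega)

/-- A vector has only finitely many expressions as a sum of positive roots, so that the count in
`kostantPartition` below is a count of a finite set. -/
theorem finite_partitions (r : ℕ) (ξ : V r) :
    {c : positiveRoots r → ℕ | ∑ β, c β • (β : V r) = ξ}.Finite := by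
  obtain ⟨N, hN⟩ := exists_nat_ge (∑ j : Fin (r + 1), -(j : ℝ) * ξ j)
  refine (Set.Finite.pi' fun _ => Set.finite_Iic N).subset ?_
  intro c hc β
  rw [Set.mem_ofPred_eq] at hc
  have key : ∑ j : Fin (r + 1), -(j : ℝ) * ξ j
      = ∑ β, (c β : ℝ) * ∑ j : Fin (r + 1), -(j : ℝ) * (β : V r) j := by
    rw [← hc]
    simp only [WithLp.ofLp_sum, Finset.sum_apply, Finset.mul_sum]
    rw [Finset.sum_comm]
    refine Finset.sum_congr rfl fun β _ => Finset.sum_congr rfl fun j _ => ?_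
    simp
    ring
  have hle : (c β : ℝ) ≤ ∑ β, (c β : ℝ) * ∑ j : Fin (r + 1), -(j : ℝ) * (β : V r) j := by
    refine le_trans ?_ (Finset.single_le_sum (f := fun β : positiveRoots r =>
      (c β : ℝ) * ∑ j : Fin (r + 1), -(j : ℝ) * (β : V r) j) (fun γ _ => ?_)
      (Finset.mem_univ β))
    · exact le_mul_of_one_le_right (Nat.cast_nonneg _) (one_le_height r β β.2)
    · exact mul_nonneg (Nat.cast_nonneg _) (by linarith [one_le_height r γ γ.2])
  rw [Set.mem_Iic]
  exact_mod_cast (hle.trans_eq key.symm).trans hN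

/-- Kostant's partition function `℘`: the number of ways to write `ξ` as a linear combination of
the positive roots with nonnegative integer coefficients. -/
noncomputable def kostantPartition (r : ℕ) (ξ : V r) : ℕ :=
  {c : positiveRoots r → ℕ | ∑ β, c β • (β : V r) = ξ}.ncard

/-- The Weyl alternation set `𝒜_r(wt, μ) = {σ ∈ W : ℘(σ(wt + ρ) - μ - ρ) > 0}`. -/
noncomputable def weylAlternationSet (r : ℕ) (wt μ : V r) : Set (weylGroup r) :=
  {σ | 0 < kostantPartition r ((σ : V r ≃ₗᵢ[ℝ] V r) (wt + rho r) - μ - rho r)}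

end TypeA

namespace TypeA

open Finset

/-! The Weyl group is the symmetric group permuting coordinates (`weylGroup_eq_range`), and an
integral vector of coordinate sum zero is a sum of positive roots exactly when its partial sums,
which are its coefficients on the simple roots, are nonnegative
(`kostantPartition_pos_iff_sum_nonneg`). The alternation set thus becomes a set of permutations of
`{0, …, r}`. Call excess of a `k`-element prefix the sum of its values minus `0 + ⋯ + (k - 1)`. The
condition at `k` reads: excess ≤ [0 is used] - [r is used] + `slack i k`.

The excess is therefore at most 2, so a prefix has one of four shapes: excess 0 (solid), excess 1
(gap), or one of two of excess 2 (wide gap, deep gap). Building permutations one value at a time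
gives a transfer recursion on these shapes, the `count…_step` lemmas. Where the slack vanishes and
`0` has been used, only solid and gap survive and the recursion is Fibonacci's (`countSolid_right`,
`countSolid_left`). The slack at `i` and `i + 1` admits finitely many extra moves; joining the two
Fibonacci stretches across them gives the formulas. The terms for `0` and `r` account for the
different behaviour at the ends. -/

/-- The `x`-th coordinate (counted from `0`) of `α̃ + ρ`, up to an additive constant. -/
def shiftedWeight (r x : ℕ) : ℤ := (if x = 0 then 1 else 0) - (if x = r then 1 else 0) - x

/-- The coefficient of `α_k` in `α_i + α_{i+1}`. -/
def slack (i k : ℕ) : ℤ := if k = i ∨ k = i + 1 then 1 else 0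

theorem slack_nonneg (i k : ℕ) : 0 ≤ slack i k := by unfold slack; split_ifs <;> simp

theorem slack_le_one (i k : ℕ) : slack i k ≤ 1 := by unfold slack; split_ifs <;> simp

/-! ### Admissible permutations, enumerated value by value -/

/-- The lists of length `m` that complete the one-line notation of a permutation of
`{0, …, r}` whose first `k` values form the set `S` and have partial sum `P`, with all later partial
sums admissible. -/
def completions (r i : ℕ) : ℕ → ℕ → ℤ → Finset ℕ → Finset (List ℕ)
  | 0, _, _, _ => {[]}
  | m + 1, k, P, S =>
    ((range (r + 1)).filter fun x => x ∉ S ∧ 0 ≤ P + shiftedWeight r x + k + slack i (k + 1)).biUnion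
      fun x => (completions r i m (k + 1) (P + shiftedWeight r x + k) (insert x S)).image (x :: ·)

theorem card_completions_succ (r i m k : ℕ) (P : ℤ) (S : Finset ℕ) :
    #(completions r i (m + 1) k P S) = ∑ x ∈ range (r + 1),
      if x ∉ S ∧ 0 ≤ P + shiftedWeight r x + k + slack i (k + 1) then
        #(completions r i m (k + 1) (P + shiftedWeight r x + k) (insert x S)) else 0 := by
  rw [completions, card_biUnion, sum_filter]
  · refine sum_congr rfl fun x _ => ?_
    rw [card_image_of_injective _ (List.cons_injective)]
  · intro x _ y _ hxy
    rw [Function.onFun, disjoint_left]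
    simp only [mem_image]
    rintro l ⟨a, _, rfl⟩ ⟨b, _, hb⟩
    exact hxy (List.cons.inj hb).1.symm

/-- Reduces the choice of the next value to a short explicit list `A`, everything else being used
already or too large. -/
theorem card_completions_succ_of_forall_notMem {r i m k : ℕ} {P : ℤ} {S : Finset ℕ} (A : Finset ℕ)
    (hA : ∀ x, x ∉ A → x ∉ S → P + shiftedWeight r x + k + slack i (k + 1) < 0) :
    #(completions r i (m + 1) k P S) = ∑ x ∈ A,
      if x ≤ r ∧ x ∉ S ∧ 0 ≤ P + shiftedWeight r x + k + slack i (k + 1) then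
        #(completions r i m (k + 1) (P + shiftedWeight r x + k) (insert x S)) else 0 := by
  rw [card_completions_succ]
  have h1 : ∀ x ∈ range (r + 1), (if x ∉ S ∧ 0 ≤ P + shiftedWeight r x + k + slack i (k + 1) then
        #(completions r i m (k + 1) (P + shiftedWeight r x + k) (insert x S)) else 0) =
      if x ≤ r ∧ x ∉ S ∧ 0 ≤ P + shiftedWeight r x + k + slack i (k + 1) then
        #(completions r i m (k + 1) (P + shiftedWeight r x + k) (insert x S)) else 0 := by
    intro x hx
    rw [mem_range] at hx
    simp only [show x ≤ r by omega, true_and]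
  rw [sum_congr rfl h1, sum_subset (subset_union_left (s₂ := A)),
    ← sum_subset (subset_union_right (s₁ := range (r + 1)))]
  · intro x _ hx
    refine if_neg fun h => ?_
    have := hA x hx h.2.1
    omega
  · intro x _ hx
    rw [mem_range] at hx
    exact if_neg fun h => hx (by omega)

theorem mem_completions (r i m k : ℕ) (P : ℤ) (S : Finset ℕ) (l : List ℕ) :
    l ∈ completions r i m k P S ↔ l.length = m ∧ l.Nodup ∧ (∀ x ∈ l, x ≤ r ∧ x ∉ S) ∧
      ∀ t < m, 0 ≤ P + ∑ j ∈ range (t + 1), (shiftedWeight r (l.getD j 0) + ((k + j : ℕ) : ℤ))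
        + slack i (k + t + 1) := by
  induction m generalizing k P S l with
  | zero =>
    simp only [completions, mem_singleton, List.length_eq_zero_iff]
    constructor
    · rintro rfl; simp
    · exact fun h => h.1
  | succ m ih =>
    cases l with
    | nil => simp [completions]
    | cons x l =>
      have h1 : (x :: l) ∈ completions r i (m + 1) k P S ↔ x ≤ r ∧ x ∉ S ∧
          0 ≤ P + shiftedWeight r x + k + slack i (k + 1) ∧
          l ∈ completions r i m (k + 1) (P + shiftedWeight r x + k) (insert x S) := by
        simp only [completions, mem_biUnion, mem_filter, mem_range, mem_image, List.cons.injEq,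
          Nat.lt_succ_iff]
        constructor
        · rintro ⟨y, ⟨h1, h2, h3⟩, l', h4, rfl, rfl⟩
          exact ⟨h1, h2, h3, h4⟩
        · rintro ⟨h1, h2, h3, h4⟩
          exact ⟨x, ⟨h1, h2, h3⟩, l, h4, rfl, rfl⟩
      rw [h1, ih]
      have h2 : (∀ t < m + 1, 0 ≤ P + ∑ j ∈ range (t + 1),
            (shiftedWeight r ((x :: l).getD j 0) + ((k + j : ℕ) : ℤ)) + slack i (k + t + 1)) ↔
          0 ≤ P + shiftedWeight r x + k + slack i (k + 1) ∧
          ∀ t < m, 0 ≤ P + shiftedWeight r x + k + ∑ j ∈ range (t + 1),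
            (shiftedWeight r (l.getD j 0) + ((k + 1 + j : ℕ) : ℤ)) + slack i (k + 1 + t + 1) := by
        have h3 : ∀ t, P + ∑ j ∈ range (t + 1),
            (shiftedWeight r ((x :: l).getD j 0) + ((k + j : ℕ) : ℤ)) =
            P + shiftedWeight r x + k + ∑ j ∈ range t,
            (shiftedWeight r (l.getD j 0) + ((k + 1 + j : ℕ) : ℤ)) := by
          intro t
          rw [sum_range_succ']
          simp only [List.getD_cons_succ, List.getD_cons_zero, add_zero]
          rw [sum_congr rfl fun j _ => by rw [show k + (j + 1) = k + 1 + j by omega]]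
          ring
        simp only [h3]
        constructor
        · intro h
          refine ⟨by simpa using h 0 (by omega), fun t ht => ?_⟩
          have := h (t + 1) (by omega)
          rwa [show k + (t + 1) + 1 = k + 1 + t + 1 by omega] at this
        · rintro ⟨h, h'⟩ t ht
          cases t with
          | zero => simpa using h
          | succ t =>
            rw [show k + (t + 1) + 1 = k + 1 + t + 1 by omega]
            exact h' t (by omega)
      rw [h2]
      simp only [List.length_cons, List.nodup_cons, List.mem_cons, forall_eq_or_imp,
        Finset.mem_insert, not_or, Nat.add_right_cancel_iff]
      constructor
      · rintro ⟨a1, a2, a3, a4, a5, a6, a7⟩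
        exact ⟨a4, ⟨fun h => (a6 x h).2.1 rfl, a5⟩, ⟨⟨a1, a2⟩, fun y hy => ⟨(a6 y hy).1,
          (a6 y hy).2.2⟩⟩, a3, a7⟩
      · rintro ⟨a4, ⟨a8, a5⟩, ⟨⟨a1, a2⟩, a6⟩, a3, a7⟩
        exact ⟨a1, a2, a3, a4, a5, fun y hy => ⟨(a6 y hy).1, fun h => a8 (h ▸ hy), (a6 y hy).2⟩, a7⟩

/-- The permutations of `{0, …, r}` all of whose partial sums are admissible. -/
def admissiblePerms (r i : ℕ) : Set (Equiv.Perm (Fin (r + 1))) :=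
  {π | ∀ k, 1 ≤ k → k ≤ r →
    0 ≤ ∑ j : Fin (r + 1), (if (j : ℕ) < k then shiftedWeight r (π j) + ((j : ℕ) : ℤ) else 0)
      + slack i k}

theorem sum_fin_ite_lt {r k : ℕ} (hk : k ≤ r + 1) (f : ℕ → ℤ) :
    ∑ j : Fin (r + 1), (if (j : ℕ) < k then f j else 0) = ∑ j ∈ range k, f j := by
  rw [Fin.sum_univ_eq_sum_range (fun j => if j < k then f j else 0), ← sum_filter]
  congr 1
  ext j
  simp only [mem_filter, mem_range]
  omega

theorem sum_range_shiftedWeight (r : ℕ) :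
    ∑ j ∈ range (r + 1), (shiftedWeight r j + (j : ℤ)) = 0 := by
  simp [shiftedWeight, sum_sub_distrib]

theorem sum_shiftedWeight_perm {r : ℕ} (π : Equiv.Perm (Fin (r + 1))) :
    ∑ j : Fin (r + 1), (shiftedWeight r (π j) + ((j : ℕ) : ℤ)) = 0 := by
  rw [sum_add_distrib, Equiv.sum_comp π (fun j => shiftedWeight r (j : ℕ)), ← sum_add_distrib,
    Fin.sum_univ_eq_sum_range (fun j => shiftedWeight r j + (j : ℤ)), sum_range_shiftedWeight]

theorem ncard_admissiblePerms (r i : ℕ) :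
    (admissiblePerms r i).ncard = #(completions r i (r + 1) 0 0 ∅) := by
  rw [← Set.ncard_coe_finset]
  have key : ∀ π : Equiv.Perm (Fin (r + 1)), ∀ k ≤ r + 1,
      ∑ j ∈ range k, (shiftedWeight r ((List.ofFn fun j => (π j : ℕ)).getD j 0) + ((0 + j : ℕ) : ℤ))
      = ∑ j : Fin (r + 1), (if (j : ℕ) < k then shiftedWeight r (π j) + ((j : ℕ) : ℤ) else 0) := by
    intro π k hk
    rw [← sum_fin_ite_lt hk]
    refine sum_congr rfl fun j _ => ?_
    simp [List.getD_eq_getElem?_getD, -List.ofFn_succ, Nat.lt_succ_iff.1 j.2]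
  refine Set.ncard_congr (fun π _ => List.ofFn fun j => (π j : ℕ)) ?_ ?_ ?_
  · intro π hπ
    rw [mem_coe, mem_completions]
    refine ⟨by simp, ?_, ?_, ?_⟩
    · rw [List.nodup_ofFn]
      exact Fin.val_injective.comp π.injective
    · intro x hx
      obtain ⟨j, rfl⟩ := List.mem_ofFn.1 hx
      exact ⟨by omega, by simp⟩
    · intro t ht
      rw [key π (t + 1) (by omega)]
      rcases (show t + 1 ≤ r ∨ t = r by omega) with h | rfl
      · have := hπ (t + 1) (by omega) h
        simpa using this
      -- `completions` also tests the full prefix of length `r + 1`, which `admissiblePerms` omits;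
      -- its total is zero, so nothing is lost.
      · have := slack_nonneg i (0 + t + 1)
        simp only [Fin.is_lt, if_true, sum_shiftedWeight_perm]
        omega
  · intro π τ _ _ h
    have := List.ofFn_injective h
    ext j
    exact congrFun this j
  · intro l hl
    rw [mem_coe, mem_completions] at hl
    obtain ⟨h1, h2, h3, h4⟩ := hl
    let f : Fin (r + 1) → Fin (r + 1) := fun j =>
      ⟨l.get ⟨j, by omega⟩, Nat.lt_succ_of_le (h3 _ (List.get_mem _ _)).1⟩
    have hf : Function.Injective f := by
      intro a b hab
      have := List.nodup_iff_injective_get.1 h2 (Fin.mk.inj hab)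
      exact Fin.ext (Fin.mk.inj this)
    let π : Equiv.Perm (Fin (r + 1)) := Equiv.ofBijective f (Finite.injective_iff_bijective.1 hf)
    have hl : (List.ofFn fun j => (π j : ℕ)) = l := by
      apply List.ext_getElem
      · simp [h1]
      · intro j _ _
        simp [π, f, -List.ofFn_succ]
    refine ⟨π, ?_, hl⟩
    intro k hk hkr
    have := h4 (k - 1) (by omega)
    rw [← hl, show k - 1 + 1 = k by omega, key π k (by omega),
      show 0 + (k - 1) + 1 = k by omega] at this
    simpa using this

/-! ### Transfer recursion on the four prefix shapes -/

/-- The number of completions when the first `k` values are `{0, …, k - 1}`. -/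
def countSolid (r i k : ℕ) : ℕ :=
  #(completions r i (r + 1 - k) k ((if 1 ≤ k then 1 else 0) - (if r + 1 ≤ k then 1 else 0)) (range k))

/-- The number of completions when the first `k` values are `{0, …, k - 2} ∪ {k}`. -/
def countGap (r i k : ℕ) : ℕ :=
  #(completions r i (r + 1 - k) k ((if 2 ≤ k then 1 else 0) - (if k = r then 1 else 0) - 1)
    (insert k (range (k - 1))))

/-- The number of completions when the first `k` values are `{0, …, k - 2} ∪ {k + 1}`. -/
def countWideGap (r i k : ℕ) : ℕ :=
  #(completions r i (r + 1 - k) k ((if 2 ≤ k then 1 else 0) - (if k + 1 = r then 1 else 0) - 2)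
    (insert (k + 1) (range (k - 1))))

/-- The number of completions when the first `k` values are `{0, …, k - 3} ∪ {k - 1, k}`. -/
def countDeepGap (r i k : ℕ) : ℕ :=
  #(completions r i (r + 1 - k) k ((if 3 ≤ k then 1 else 0) - (if k = r then 1 else 0) - 2)
    (insert k (insert (k - 1) (range (k - 2)))))

theorem ite_card_completions_congr {r i m m' k : ℕ} {P P' : ℤ} {S S' : Finset ℕ} {a b : Prop}
    [Decidable a] [Decidable b] (hab : a ↔ b) (hm : m = m') (hP : b → P = P') (hS : S = S') :
    (if a then #(completions r i m k P S) else 0) =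
      if b then #(completions r i m' k P' S') else 0 := by
  subst hm hS
  by_cases hb : b
  · rw [if_pos hb, if_pos (hab.2 hb), hP hb]
  · rw [if_neg hb, if_neg (hb ∘ hab.1)]

theorem countSolid_eq_one {r i : ℕ} : countSolid r i (r + 1) = 1 := by
  simp [countSolid, completions]

/-- Appending `x` in position `k` adds `x - k` to the excess, so only `k`, `k + 1` and `k + 2` keep
it within 2. They lead to solid, gap and wide gap; the conditions compare excess 1 or 2 with the
bound at `k + 1`. -/
theorem countSolid_step {r i k : ℕ} (hk : k ≤ r) :
    countSolid r i k = countSolid r i (k + 1) +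
      (if k + 1 ≤ r ∧ 1 ≤ (if 1 ≤ k then 1 else 0) - (if k + 1 = r then 1 else 0) + slack i (k + 1)
        then countGap r i (k + 1) else 0) +
      (if k + 2 ≤ r ∧ 2 ≤ (if 1 ≤ k then 1 else 0) - (if k + 2 = r then 1 else 0) + slack i (k + 1)
        then countWideGap r i (k + 1) else 0) := by
  have h0 := slack_nonneg i (k + 1)
  have h1 := slack_le_one i (k + 1)
  have h2 : countSolid r i (k + 1) = if True then countSolid r i (k + 1) else 0 := by simp
  rw [h2]
  unfold countSolid countGap countWideGap
  rw [show r + 1 - k = (r - k) + 1 by omega,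
    card_completions_succ_of_forall_notMem {k, k + 1, k + 2}, sum_insert (by simp),
    sum_insert (by simp), sum_singleton, ← add_assoc]
  · congr 1
    congr 1
    all_goals
      refine ite_card_completions_congr ?_ (by omega) ?_ ?_
      · unfold shiftedWeight
        simp only [mem_range]
        split_ifs <;> first | contradiction | omega | (simp only [iff_true]; omega)
      · intro hb
        unfold shiftedWeight
        split_ifs at hb ⊢ <;> first | contradiction | omega
      · ext x
        simp only [mem_range, mem_insert]
        omega
  · intro x hx hxS
    simp only [mem_insert, mem_singleton, mem_range] at hx hxS
    unfold shiftedWeight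
    split_ifs <;> omega

/-- Either the hole `k - 1` is filled, or `k + 1` is appended, which deepens the hole. The bonus for
`0` needs `2 ≤ k`, since at `k = 1` the hole is `0` itself. -/
theorem countGap_step {r i k : ℕ} (hk : 1 ≤ k) (hkr : k ≤ r) :
    countGap r i k = countSolid r i (k + 1) +
      (if k + 1 ≤ r ∧ 2 ≤ (if 2 ≤ k then 1 else 0) - (if k + 1 = r then 1 else 0) + slack i (k + 1)
        then countDeepGap r i (k + 1) else 0) := by
  have h0 := slack_nonneg i (k + 1)
  have h1 := slack_le_one i (k + 1)
  have h2 : countSolid r i (k + 1) = if True then countSolid r i (k + 1) else 0 := by simp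
  rw [h2]
  unfold countSolid countGap countDeepGap
  rw [show r + 1 - k = (r - k) + 1 by omega,
    card_completions_succ_of_forall_notMem {k - 1, k + 1},
    sum_insert (by simp only [mem_singleton]; omega), sum_singleton]
  · congr 1
    all_goals
      refine ite_card_completions_congr ?_ (by omega) ?_ ?_
      · unfold shiftedWeight
        simp only [mem_range, mem_insert]
        split_ifs <;> first | contradiction | omega | (simp only [iff_true]; omega)
      · intro hb
        unfold shiftedWeight
        split_ifs at hb ⊢ <;> first | contradiction | omega
      · ext x
        simp only [mem_range, mem_insert]
        omega
  · intro x hx hxS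
    simp only [mem_insert, mem_singleton, mem_range] at hx hxS
    unfold shiftedWeight
    split_ifs <;> omega

theorem countWideGap_step {r i k : ℕ} (hk : 2 ≤ k) (hkr : k + 1 ≤ r) :
    countWideGap r i k =
      (if 1 ≤ 1 - (if k + 1 = r then 1 else 0) + slack i (k + 1)
        then countGap r i (k + 1) else 0) +
      (if 2 ≤ 1 - (if k + 1 = r then 1 else 0) + slack i (k + 1)
        then countDeepGap r i (k + 1) else 0) := by
  have h0 := slack_nonneg i (k + 1)
  have h1 := slack_le_one i (k + 1)
  unfold countWideGap countGap countDeepGap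
  rw [show r + 1 - k = (r - k) + 1 by omega,
    card_completions_succ_of_forall_notMem {k - 1, k},
    sum_insert (by simp only [mem_singleton]; omega), sum_singleton]
  · congr 1
    all_goals
      refine ite_card_completions_congr ?_ (by omega) ?_ ?_
      · unfold shiftedWeight
        simp only [mem_range, mem_insert]
        split_ifs <;> first | contradiction | omega
      · intro hb
        unfold shiftedWeight
        split_ifs at hb ⊢ <;> first | contradiction | omega
      · ext x
        simp only [mem_range, mem_insert]
        omega
  · intro x hx hxS
    simp only [mem_insert, mem_singleton, mem_range] at hx hxS
    unfold shiftedWeight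
    split_ifs <;> omega

/-- Any value other than the hole `k - 2` would push the excess to at least 3, so the hole must be
filled. -/
theorem countDeepGap_step {r i k : ℕ} (hk : 2 ≤ k) (hkr : k ≤ r) :
    countDeepGap r i k = countSolid r i (k + 1) := by
  have h0 := slack_nonneg i (k + 1)
  have h1 := slack_le_one i (k + 1)
  have h2 : countSolid r i (k + 1) = if True then countSolid r i (k + 1) else 0 := by simp
  rw [h2]
  unfold countSolid countDeepGap
  rw [show r + 1 - k = (r - k) + 1 by omega,
    card_completions_succ_of_forall_notMem {k - 2}, sum_singleton]
  · refine ite_card_completions_congr ?_ (by omega) ?_ ?_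
    · unfold shiftedWeight
      simp only [mem_range, mem_insert]
      split_ifs <;> first | contradiction | omega | (simp only [iff_true]; omega)
    · intro hb
      unfold shiftedWeight
      split_ifs at hb ⊢ <;> first | contradiction | omega
    · ext x
      simp only [mem_range, mem_insert]
      omega
  · intro x hx hxS
    simp only [mem_insert, mem_singleton, mem_range] at hx hxS
    unfold shiftedWeight
    split_ifs <;> omega

/-! ### Fibonacci stretches on either side of `i` and `i + 1` -/

theorem slack_eq_zero {i k : ℕ} (h : k ≠ i) (h' : k ≠ i + 1) : slack i k = 0 := by
  simp [slack, h, h']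

theorem slack_self (i : ℕ) : slack i i = 1 := by simp [slack]

theorem slack_succ (i : ℕ) : slack i (i + 1) = 1 := by simp [slack]

theorem countSolid_step_of_slack_eq_zero {r i k : ℕ} (hs : slack i (k + 1) = 0) (hk : 1 ≤ k)
    (hkr : k + 2 ≤ r) : countSolid r i k = countSolid r i (k + 1) + countGap r i (k + 1) := by
  rw [countSolid_step (by omega), if_pos, if_neg, add_zero] <;> rw [hs] <;> split_ifs <;> omega

theorem countGap_step_of_slack_eq_zero {r i k : ℕ} (hs : slack i (k + 1) = 0) (hk : 1 ≤ k)
    (hkr : k ≤ r) : countGap r i k = countSolid r i (k + 1) := by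
  rw [countGap_step hk hkr, if_neg, add_zero]
  rw [hs]; split_ifs <;> omega

/-- Without slack at 1, the first value must be `0`: any other has positive excess and lacks the
bonus for `0`. -/
theorem countSolid_zero {r i : ℕ} (hr : 2 ≤ r) (hi : 2 ≤ i) :
    countSolid r i 0 = countSolid r i 1 := by
  rw [countSolid_step (by omega), if_neg, if_neg, add_zero, add_zero]
  all_goals
    rw [slack_eq_zero (by omega) (by omega)]
    split_ifs <;> omega

/-- Beyond `i + 1` a gap must be filled at once, so one advances by one or two positions. A gap at
length `r` would use `r`, whose penalty cancels the bonus for `0`; hence the value 1 at `d = 1`. -/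
theorem countSolid_right {r i : ℕ} (d : ℕ) (hd : d ≤ r) (h : i < r - d) :
    countSolid r i (r - d) = Nat.fib (d + 1) := by
  induction d using Nat.strong_induction_on with
  | _ d ih =>
    match d with
    | 0 =>
      rw [countSolid_step (by omega), if_neg (by omega), if_neg (by omega), Nat.sub_zero,
        countSolid_eq_one]
      rfl
    | 1 =>
      have hs : slack i (r - 1 + 1) = 0 := slack_eq_zero (by omega) (by omega)
      rw [countSolid_step (by omega), if_neg, if_neg (by omega)]
      · have := ih 0 (by omega) (by omega) (by omega)
        rw [show r - 1 + 1 = r - 0 by omega, this]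
        rfl
      · rw [hs]; split_ifs <;> omega
    | d + 2 =>
      rw [countSolid_step_of_slack_eq_zero (slack_eq_zero (by omega) (by omega)) (by omega)
        (by omega), countGap_step_of_slack_eq_zero (slack_eq_zero (by omega) (by omega)) (by omega)
        (by omega), show r - (d + 2) + 1 = r - (d + 1) by omega,
        show r - (d + 1) + 1 = r - d by omega, ih (d + 1) (by omega) (by omega) (by omega),
        ih d (by omega) (by omega) (by omega), Nat.fib_add_two (n := d + 1), add_comm]

theorem countSolid_left {r i p : ℕ} (m : ℕ) (hm : m < p) (hp : p < i) (hir : i + 1 ≤ r) :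
    countSolid r i (p - m) = Nat.fib (m + 1) * countSolid r i p + Nat.fib m * countGap r i p := by
  induction m using Nat.strong_induction_on with
  | _ m ih =>
    match m with
    | 0 => simp
    | 1 =>
      rw [countSolid_step_of_slack_eq_zero (slack_eq_zero (by omega) (by omega)) (by omega)
        (by omega), show p - 1 + 1 = p by omega]
      simp
    | m + 2 =>
      rw [countSolid_step_of_slack_eq_zero (slack_eq_zero (by omega) (by omega)) (by omega)
        (by omega), countGap_step_of_slack_eq_zero (slack_eq_zero (by omega) (by omega)) (by omega)
        (by omega), show p - (m + 2) + 1 = p - (m + 1) by omega,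
        show p - (m + 1) + 1 = p - m by omega, ih (m + 1) (by omega) (by omega),
        ih m (by omega) (by omega), Nat.fib_add_two (n := m + 1), Nat.fib_add_two (n := m)]
      ring

/-! ### Positivity of Kostant's partition function via partial sums -/

theorem e_apply (r k : ℕ) (j : Fin (r + 1)) : e r k j = if (j : ℕ) + 1 = k then 1 else 0 := rfl

theorem rootSum_eq (r i j : ℕ) (hij : i ≤ j + 1) : rootSum r i j = e r i - e r (j + 1) := by
  rw [rootSum, ← Finset.Ico_add_one_right_eq_Icc, ← neg_sub (e r (j + 1)), ← sum_Ico_sub (e r) hij,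
    ← sum_neg_distrib]
  simp [simpleRoot]

/-- The sum of the first `k` coordinates. -/
noncomputable def partialSum (r k : ℕ) (v : V r) : ℝ :=
  ∑ j : Fin (r + 1), if (j : ℕ) < k then v j else 0

theorem partialSum_e (r k m : ℕ) (hm : 1 ≤ m) (hmr : m ≤ r + 1) :
    partialSum r k (e r m) = if m ≤ k then 1 else 0 := by
  rw [partialSum, sum_eq_single (⟨m - 1, by omega⟩ : Fin (r + 1))]
  · simp only [e_apply]
    split_ifs <;> first | rfl | omega
  · intro b _ hb
    have : (b : ℕ) ≠ m - 1 := fun h => hb (Fin.ext h)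
    rw [e_apply, if_neg (show ¬(b : ℕ) + 1 = m by omega), ite_self]
  · simp

theorem partialSum_sub (r k : ℕ) (v w : V r) :
    partialSum r k (v - w) = partialSum r k v - partialSum r k w := by
  simp only [partialSum, ← sum_sub_distrib, PiLp.sub_apply]
  exact sum_congr rfl fun j _ => by split_ifs <;> simp

theorem partialSum_sum_nsmul (r k : ℕ) {ι : Type*} [Fintype ι] (c : ι → ℕ) (v : ι → V r) :
    partialSum r k (∑ b, c b • v b) = ∑ b, c b • partialSum r k (v b) := by
  simp only [partialSum, WithLp.ofLp_sum, Finset.sum_apply, smul_sum]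
  rw [sum_comm]
  refine sum_congr rfl fun j _ => ?_
  split_ifs <;> simp

theorem mem_positiveRoots {r : ℕ} {β : V r} :
    β ∈ positiveRoots r ↔ ∃ a b, 1 ≤ a ∧ a ≤ b ∧ b ≤ r ∧ β = e r a - e r (b + 1) := by
  simp only [positiveRoots, mem_image, mem_filter, mem_product, mem_Icc, Prod.exists]
  constructor
  · rintro ⟨a, b, h, rfl⟩
    exact ⟨a, b, by omega, by omega, by omega, rootSum_eq r a b (by omega)⟩
  · rintro ⟨a, b, h1, h2, h3, rfl⟩
    exact ⟨a, b, by omega, rootSum_eq r a b (by omega)⟩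

theorem simpleRoot_mem_positiveRoots {r k : ℕ} (hk : 1 ≤ k) (hkr : k ≤ r) :
    simpleRoot r k ∈ positiveRoots r :=
  mem_positiveRoots.2 ⟨k, k, hk, le_rfl, hkr, rfl⟩

theorem partialSum_nonneg_of_mem_positiveRoots {r : ℕ} (k : ℕ) {β : V r}
    (hβ : β ∈ positiveRoots r) : 0 ≤ partialSum r k β := by
  obtain ⟨a, b, h1, h2, h3, rfl⟩ := mem_positiveRoots.1 hβ
  rw [partialSum_sub, partialSum_e _ _ _ h1 (by omega), partialSum_e _ _ _ (by omega) (by omega)]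
  split_ifs <;> first | omega | norm_num

theorem kostantPartition_pos_iff (r : ℕ) (ξ : V r) :
    0 < kostantPartition r ξ ↔ ∃ c : positiveRoots r → ℕ, ∑ β, c β • (β : V r) = ξ := by
  rw [kostantPartition, Set.ncard_pos (finite_partitions r ξ)]
  rfl

theorem sum_smul_simpleRoot_apply (r : ℕ) (p : ℕ → ℝ) (h0 : p 0 = 0) (hr : p (r + 1) = 0)
    (j : Fin (r + 1)) :
    (∑ k ∈ Icc 1 r, p k • simpleRoot r k) j = p (j + 1) - p j := by
  have h1 : ∀ k ∈ Icc 1 r, (p k • simpleRoot r k) j =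
      (if (j : ℕ) + 1 = k then p k else 0) - (if (j : ℕ) = k then p k else 0) := by
    intro k _
    simp [simpleRoot, e_apply, mul_sub]
  rw [WithLp.ofLp_sum, Finset.sum_apply, sum_congr rfl h1, sum_sub_distrib, sum_ite_eq, sum_ite_eq]
  simp only [mem_Icc]
  have := j.2
  congr 1
  · split_ifs with h
    · rfl
    · rw [show (j : ℕ) = r by omega, hr]
  · split_ifs with h
    · rfl
    · rw [show (j : ℕ) = 0 by omega, h0]

/-- An integral vector of coordinate sum zero is a sum of positive roots if and only if its partial
sums are nonnegative. -/
theorem kostantPartition_pos_iff_sum_nonneg {r : ℕ} {ξ : V r} {z : Fin (r + 1) → ℤ}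
    (hz : ∀ j, ξ j = z j) (hsum : ∑ j, z j = 0) :
    0 < kostantPartition r ξ ↔
      ∀ k, 1 ≤ k → k ≤ r → 0 ≤ ∑ j : Fin (r + 1), if (j : ℕ) < k then z j else 0 := by
  classical
  have hpart : ∀ k, partialSum r k ξ =
      ((∑ j : Fin (r + 1), if (j : ℕ) < k then z j else 0 : ℤ) : ℝ) := by
    intro k
    push_cast
    exact sum_congr rfl fun j _ => by rw [hz]
  rw [kostantPartition_pos_iff]
  constructor
  · rintro ⟨c, hc⟩ k _ _
    have h1 : 0 ≤ partialSum r k ξ := by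
      rw [← hc, partialSum_sum_nsmul]
      exact sum_nonneg fun β _ => nsmul_nonneg (partialSum_nonneg_of_mem_positiveRoots k β.2) _
    rw [hpart] at h1
    exact_mod_cast h1
  · intro h
    set p : ℕ → ℤ := fun k => ∑ j : Fin (r + 1), if (j : ℕ) < k then z j else 0 with hp
    have hξ : ∑ k ∈ Icc 1 r, (p k).toNat • simpleRoot r k = ξ := by
      have h1 : ∀ k ∈ Icc 1 r, (p k).toNat • simpleRoot r k = (p k : ℝ) • simpleRoot r k := by
        intro k hk
        rw [mem_Icc] at hk
        rw [← Nat.cast_smul_eq_nsmul ℝ, ← Int.cast_natCast, Int.toNat_of_nonneg (h k hk.1 hk.2)]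
      ext j
      rw [sum_congr rfl h1, sum_smul_simpleRoot_apply r (fun k => (p k : ℝ)), hz, ← Int.cast_sub]
      · congr 1
        rw [hp, ← sum_sub_distrib, sum_eq_single j]
        · simp
        · intro b _ hb
          have : (b : ℕ) ≠ j := fun h => hb (Fin.ext h)
          split_ifs <;> omega
        · simp
      · simp [hp]
      · simp only [hp, Fin.is_lt, if_true, hsum, Int.cast_zero]
    -- Simple roots alone suffice. Summing over `k` avoids proving that the simple roots are
    -- distinct.
    refine ⟨fun β => ∑ k ∈ Icc 1 r, if simpleRoot r k = β then (p k).toNat else 0, ?_⟩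
    rw [← hξ]
    simp only [sum_smul, ite_smul, zero_smul]
    rw [sum_comm]
    refine sum_congr rfl fun k hk => ?_
    rw [mem_Icc] at hk
    rw [sum_eq_single (⟨simpleRoot r k, simpleRoot_mem_positiveRoots hk.1 hk.2⟩ : positiveRoots r)]
    · simp
    · intro b _ hb
      exact if_neg fun h => hb (Subtype.ext h.symm)
    · simp

/-! ### Coordinates of `ρ` and of the shifted highest root -/

theorem sum_positiveRoots (r : ℕ) :
    ∑ β ∈ positiveRoots r, β = ∑ a ∈ Icc 1 r, ∑ b ∈ Icc a r, (e r a - e r (b + 1)) := by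
  classical
  rw [positiveRoots, sum_image, sum_sigma']
  · refine sum_bij' (fun p _ => ⟨p.1, p.2⟩) (fun p _ => (p.1, p.2)) ?_ ?_ ?_ ?_ ?_
    · intro p hp; simp only [mem_filter, mem_product, mem_Icc, mem_sigma] at hp ⊢; omega
    · intro p hp; simp only [mem_filter, mem_product, mem_Icc, mem_sigma] at hp ⊢; omega
    · intro p _; rfl
    · intro p _; rfl
    · intro p hp
      simp only [mem_filter, mem_product, mem_Icc] at hp
      exact rootSum_eq _ _ _ (by omega)
  · rintro ⟨a, b⟩ hp ⟨a', b'⟩ hp' h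
    simp only [coe_filter, mem_product, mem_Icc, Set.mem_ofPred_eq] at hp hp'
    simp only at h
    rw [rootSum_eq _ _ _ (by omega), rootSum_eq _ _ _ (by omega)] at h
    -- The positions of the entries `1` and `-1` recover both endpoints of the root.
    have h1 := congrArg (fun v : V r => v ⟨a - 1, by omega⟩) h
    have h2 := congrArg (fun v : V r => v ⟨b, by omega⟩) h
    simp only [PiLp.sub_apply, e_apply] at h1 h2
    ext <;> by_contra hne <;> simp only at hne
    · revert h1; split_ifs <;> first | omega | norm_num
    · revert h2; split_ifs <;> first | omega | norm_num

theorem rho_apply (r : ℕ) (j : Fin (r + 1)) : rho r j = r / 2 - (j : ℕ) := by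
  have hj := j.2
  have h1 : ∀ a ∈ Icc 1 r, (∑ b ∈ Icc a r, (e r a - e r (b + 1))) j =
      (if (j : ℕ) + 1 = a then (r - j : ℝ) else 0) - if a ≤ j then 1 else 0 := by
    intro a ha
    rw [mem_Icc] at ha
    rw [WithLp.ofLp_sum, Finset.sum_apply]
    simp only [PiLp.sub_apply, e_apply, sum_sub_distrib, Nat.add_right_cancel_iff, sum_ite_eq,
      mem_Icc, sum_const, Nat.card_Icc]
    congr 1
    · split_ifs with h
      · rw [show r + 1 - a = r - j by omega, nsmul_eq_mul, Nat.cast_sub (by omega)]; simp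
      · simp
    · split_ifs <;> first | omega | rfl
  rw [rho, sum_positiveRoots, PiLp.smul_apply, WithLp.ofLp_sum, Finset.sum_apply, sum_congr rfl h1,
    sum_sub_distrib, sum_ite_eq, ← sum_filter]
  have h2 : (Icc 1 r).filter (· ≤ (j : ℕ)) = Icc 1 (j : ℕ) := by
    ext a; simp only [mem_filter, mem_Icc]; omega
  rw [h2]
  simp only [mem_Icc, sum_const, Nat.card_Icc, smul_eq_mul, nsmul_eq_mul]
  split_ifs with h
  · push_cast [Nat.add_sub_cancel]; ring
  · rw [show (j : ℕ) = r by omega]; push_cast [Nat.add_sub_cancel]; ring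

theorem highestRoot_add_rho_apply {r : ℕ} (hr : 1 ≤ r) (j : Fin (r + 1)) :
    (highestRoot r + rho r) j = r / 2 + shiftedWeight r j := by
  rw [highestRoot, rootSum_eq _ _ _ (by omega)]
  simp only [PiLp.add_apply, PiLp.sub_apply, e_apply, rho_apply, shiftedWeight,
    Nat.add_eq_right, Nat.add_right_cancel_iff]
  push_cast
  ring

/-! ### The Weyl group as the symmetric group -/

/-- The action of permutations on coordinates, by isometries. -/
noncomputable def permIsometry (r : ℕ) : Equiv.Perm (Fin (r + 1)) →* (V r ≃ₗᵢ[ℝ] V r) where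
  toFun π := LinearIsometryEquiv.piLpCongrLeft 2 ℝ ℝ π
  map_one' := by ext; rfl
  map_mul' _ _ := by ext; rfl

theorem permIsometry_apply {r : ℕ} (π : Equiv.Perm (Fin (r + 1))) (v : V r) (j : Fin (r + 1)) :
    permIsometry r π v j = v (π⁻¹ j) := rfl

theorem permIsometry_injective (r : ℕ) : Function.Injective (permIsometry r) := by
  intro π τ h
  rw [← inv_inj]
  ext j
  -- A vector with pairwise distinct coordinates detects the permutation.
  have := congrArg (fun f : V r ≃ₗᵢ[ℝ] V r => f (WithLp.toLp 2 fun x => ((x : ℕ) : ℝ)) j) h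
  simp only [permIsometry_apply] at this
  exact_mod_cast this

theorem simpleReflection_eq_permIsometry {r : ℕ} (k : Fin r) :
    simpleReflection r (k + 1) = permIsometry r (Equiv.swap k.castSucc k.succ) := by
  have hroot : simpleRoot r (k + 1) =
      EuclideanSpace.single k.castSucc (1 : ℝ) - EuclideanSpace.single k.succ 1 := by
    ext j
    simp [simpleRoot, e_apply, Fin.ext_iff]
  have hne : k.succ ≠ k.castSucc := by simp [Fin.ext_iff]
  ext v j
  rw [simpleReflection, Submodule.reflection_orthogonal_apply,
    Submodule.reflection_singleton_apply, permIsometry_apply, Equiv.swap_inv]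
  have hn : ‖simpleRoot r (k + 1)‖ ^ 2 = 2 := by
    rw [hroot, ← real_inner_self_eq_norm_sq]
    simp only [inner_sub_left, inner_sub_right, EuclideanSpace.inner_single_left]
    simp [hne, hne.symm]
    norm_num
  simp only [RCLike.ofReal_real_eq_id, id_eq, hn]
  rw [hroot]
  simp only [inner_sub_left, EuclideanSpace.inner_single_left, map_one, one_mul]
  by_cases h1 : j = k.castSucc
  · subst h1
    simp [hne.symm]
    ring
  · by_cases h2 : j = k.succ
    · subst h2
      simp [hne]
      ring
    · rw [Equiv.swap_apply_of_ne_of_ne h1 h2]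
      simp [h1, h2]

theorem weylGroup_eq_range (r : ℕ) : weylGroup r = (permIsometry r).range := by
  have hgen : {s | ∃ k, 1 ≤ k ∧ k ≤ r ∧ s = simpleReflection r k} =
      permIsometry r '' Set.range fun k : Fin r => Equiv.swap k.castSucc k.succ := by
    ext s
    constructor
    · rintro ⟨k, h1, h2, rfl⟩
      refine ⟨_, ⟨⟨k - 1, by omega⟩, rfl⟩, ?_⟩
      rw [← simpleReflection_eq_permIsometry, show k - 1 + 1 = k by omega]
    · rintro ⟨_, ⟨k, rfl⟩, rfl⟩
      exact ⟨k + 1, by omega, by omega, (simpleReflection_eq_permIsometry k).symm⟩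
  have htop : Subgroup.closure (Set.range fun k : Fin r => Equiv.swap k.castSucc k.succ) = ⊤ :=
    Subgroup.closure_eq_top_of_mclosure_eq_top (Equiv.Perm.mclosure_swap_castSucc_succ r)
  rw [weylGroup, hgen, ← MonoidHom.map_closure, htop, MonoidHom.range_eq_map]

/-- The inverse makes coordinate `j` read entry `π j`. The constant `r / 2` cancels against `ρ`, and
`-μ = e_i - e_{i+2}` has partial sums `slack i k`. -/
theorem kostantPartition_permIsometry_inv_pos_iff {r i : ℕ} (hi : 1 ≤ i) (hir : i + 1 ≤ r)
    (π : Equiv.Perm (Fin (r + 1))) :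
    0 < kostantPartition r (permIsometry r π⁻¹ (highestRoot r + rho r) -
      (-simpleRoot r i - simpleRoot r (i + 1)) - rho r) ↔ π ∈ admissiblePerms r i := by
  set z : Fin (r + 1) → ℤ := fun j => shiftedWeight r (π j) + ((j : ℕ) : ℤ) +
    ((if (j : ℕ) + 1 = i then 1 else 0) - (if (j : ℕ) + 1 = i + 2 then 1 else 0)) with hz
  have hS : ∀ k ≤ r + 1, ∑ j : Fin (r + 1), (if (j : ℕ) < k then
      (if (j : ℕ) + 1 = i then (1 : ℤ) else 0) - (if (j : ℕ) + 1 = i + 2 then 1 else 0) else 0) =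
      slack i k := by
    intro k hk
    rw [sum_fin_ite_lt hk
      (fun j => (if j + 1 = i then (1 : ℤ) else 0) - (if j + 1 = i + 2 then 1 else 0)),
      sum_sub_distrib]
    simp only [show ∀ j, j + 1 = i ↔ j = i - 1 from fun j => by omega,
      show ∀ j, j + 1 = i + 2 ↔ j = i + 1 from fun j => by omega, sum_ite_eq', mem_range, slack]
    split_ifs <;> omega
  rw [kostantPartition_pos_iff_sum_nonneg (z := z)]
  · refine forall₃_congr fun k _ hk => ?_
    rw [← hS k (by omega), ← sum_add_distrib]
    have : ∀ j : Fin (r + 1), (if (j : ℕ) < k then z j else 0) =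
      (if (j : ℕ) < k then shiftedWeight r (π j) + ((j : ℕ) : ℤ) else 0) + (if (j : ℕ) < k then
      (if (j : ℕ) + 1 = i then (1 : ℤ) else 0) - (if (j : ℕ) + 1 = i + 2 then 1 else 0) else 0) := by
      intro j
      by_cases hjk : (j : ℕ) < k
      · simp only [hz, if_pos hjk]
      · simp only [if_neg hjk, add_zero]
    rw [sum_congr rfl fun j _ => this j]
  · intro j
    rw [PiLp.sub_apply, PiLp.sub_apply, permIsometry_apply, inv_inv,
      highestRoot_add_rho_apply (by omega), rho_apply, hz]
    simp only [PiLp.sub_apply, PiLp.neg_apply, simpleRoot, e_apply]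
    push_cast
    ring
  · have := hS (r + 1) le_rfl
    simp only [Fin.is_lt, if_true] at this
    rw [hz, sum_add_distrib, sum_shiftedWeight_perm, this, slack, if_neg (by omega), add_zero]

theorem ncard_weylAlternationSet {r i : ℕ} (hi : 1 ≤ i) (hir : i + 1 ≤ r) :
    (weylAlternationSet r (highestRoot r) (-simpleRoot r i - simpleRoot r (i + 1))).ncard =
      (admissiblePerms r i).ncard := by
  symm
  refine Set.ncard_congr (fun π _ => ⟨permIsometry r π⁻¹, ?_⟩) ?_ ?_ ?_
  · rw [weylGroup_eq_range]
    exact ⟨_, rfl⟩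
  · intro π hπ
    exact (kostantPartition_permIsometry_inv_pos_iff hi hir π).2 hπ
  · intro π τ _ _ h
    exact inv_injective (permIsometry_injective r (congrArg Subtype.val h))
  · rintro ⟨σ, hσ⟩ h
    have hσ' := hσ
    rw [weylGroup_eq_range] at hσ'
    obtain ⟨π, rfl⟩ := hσ'
    refine ⟨π⁻¹, (kostantPartition_permIsometry_inv_pos_iff hi hir _).1 ?_, ?_⟩
    · rw [inv_inv]; exact h
    · simp only [inv_inv]

/-! ### Evaluation of the counts -/

theorem countSolid_of_interior {r i : ℕ} (hi : 2 ≤ i) (hir : i + 2 ≤ r) :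
    countSolid r i 0 = Nat.fib r + Nat.fib (i - 2) * Nat.fib (r - i) +
      3 * Nat.fib (i - 1) * Nat.fib (r - i - 1) + Nat.fib i * Nat.fib (r - i - 2) := by
  obtain ⟨a, rfl⟩ : ∃ a, i = a + 2 := ⟨i - 2, by omega⟩
  obtain ⟨b, rfl⟩ : ∃ b, r = a + 2 + (b + 2) := ⟨r - (a + 2) - 2, by omega⟩
  set r := a + 2 + (b + 2) with hr
  set i := a + 2 with hia
  have hs1 : slack i (i + 1) = 1 := slack_succ i
  have hs0 : slack i (i - 1 + 1) = 1 := by rw [show i - 1 + 1 = i by omega, slack_self]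
  have hs2 : slack i (i + 1 + 1) = 0 := slack_eq_zero (by omega) (by omega)
  have s1 : countSolid r i (i + 1) = Nat.fib (b + 2) := by
    rw [show i + 1 = r - (b + 1) by omega, countSolid_right _ (by omega) (by omega)]
  have s2 : countSolid r i (i + 2) = Nat.fib (b + 1) := by
    rw [show i + 2 = r - b by omega, countSolid_right _ (by omega) (by omega)]
  have g1 : countGap r i (i + 1) = Nat.fib (b + 1) := by
    rw [countGap_step_of_slack_eq_zero hs2 (by omega) (by omega), s2]
  have d1 : countDeepGap r i (i + 1) = Nat.fib (b + 1) := by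
    rw [countDeepGap_step (by omega) (by omega), s2]
  -- When `b = 0` the wide gap would use the value `r`, whose penalty forbids it, in agreement with
  -- `F_0 = 0`.
  have w1 : (if i + 2 ≤ r ∧
      2 ≤ (if 1 ≤ i then 1 else 0) - (if i + 2 = r then 1 else 0) + slack i (i + 1)
        then countWideGap r i (i + 1) else 0) = Nat.fib b := by
    rcases Nat.eq_zero_or_pos b with hb | hb
    · rw [if_neg, hb, Nat.fib_zero]
      rw [hs1]; split_ifs <;> omega
    · rw [if_pos (by rw [hs1]; split_ifs <;> omega), countWideGap_step (by omega) (by omega),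
        if_pos (by rw [hs2]; split_ifs <;> omega), if_neg (by rw [hs2]; split_ifs <;> omega),
        countGap_step_of_slack_eq_zero (slack_eq_zero (by omega) (by omega)) (by omega) (by omega),
        show i + 1 + 1 + 1 = r - (b - 1) by omega, countSolid_right _ (by omega) (by omega),
        show b - 1 + 1 = b by omega, add_zero]
  have s0 : countSolid r i i = Nat.fib (b + 2) + Nat.fib (b + 1) + Nat.fib b := by
    rw [countSolid_step (by omega), w1, if_pos (by rw [hs1]; split_ifs <;> omega), s1, g1]
  have g0 : countGap r i i = Nat.fib (b + 2) + Nat.fib (b + 1) := by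
    rw [countGap_step (by omega) (by omega), if_pos (by rw [hs1]; split_ifs <;> omega), s1, d1]
  have w0 : countWideGap r i i = Nat.fib (b + 1) + Nat.fib (b + 1) := by
    rw [countWideGap_step (by omega) (by omega), if_pos (by rw [hs1]; split_ifs <;> omega),
      if_pos (by rw [hs1]; split_ifs <;> omega), g1, d1]
  have d0 : countDeepGap r i i = Nat.fib (b + 2) := by
    rw [countDeepGap_step (by omega) (by omega), s1]
  have sl : countSolid r i (i - 1) = countSolid r i i + countGap r i i + countWideGap r i i := by
    rw [countSolid_step (by omega), if_pos (by rw [hs0]; split_ifs <;> omega),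
      if_pos (by rw [hs0]; split_ifs <;> omega), show i - 1 + 1 = i by omega]
  -- The factor `F_a` covers `a = 0`: there `i - 1 = 1`, the bonus for `0` is missing and the deep
  -- gap is unavailable, but the term has coefficient 0.
  have gl : Nat.fib a * countGap r i (i - 1) =
      Nat.fib a * (countSolid r i i + countDeepGap r i i) := by
    rcases Nat.eq_zero_or_pos a with ha | ha
    · rw [ha, Nat.fib_zero, zero_mul, zero_mul]
    · rw [countGap_step (by omega) (by omega), if_pos (by rw [hs0]; split_ifs <;> omega),
        show i - 1 + 1 = i by omega]
  have hleft := countSolid_left (r := r) (i := i) (p := i - 1) a (by omega) (by omega) (by omega)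
  rw [show i - 1 - a = 1 by omega, gl, sl, s0, g0, w0, d0] at hleft
  have hfr : Nat.fib r = Nat.fib a * Nat.fib (b + 3) + Nat.fib (a + 1) * Nat.fib (b + 4) := by
    rw [show r = a + (b + 3) + 1 by omega, Nat.fib_add]
  have h2 : Nat.fib (b + 2) = Nat.fib b + Nat.fib (b + 1) := Nat.fib_add_two
  have h3 : Nat.fib (b + 3) = Nat.fib (b + 1) + Nat.fib (b + 2) := Nat.fib_add_two
  have h4 : Nat.fib (b + 4) = Nat.fib (b + 2) + Nat.fib (b + 3) := Nat.fib_add_two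
  rw [countSolid_zero (by omega) hi, hleft, show i - 2 = a by omega, show i - 1 = a + 1 by omega,
    show r - i = b + 2 by omega, show b + 2 - 1 = b + 1 by omega, show b + 2 - 2 = b by omega,
    hfr, hia, Nat.fib_add_two (n := a), h4, h3, h2]
  ring

/-- Slack at 1 allows the first value to be `1`, which must then be followed by `0`. A wide gap at
length 2 uses the value 3, affordable only if `3 < r`. -/
theorem countSolid_of_left_end {r : ℕ} (hr : 2 ≤ r) : countSolid r 1 0 = 3 * Int.fib (r - 1) := by
  have hs1 : slack 1 (0 + 1) = 1 := slack_self 1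
  have hs2 : slack 1 (1 + 1) = 1 := slack_succ 1
  have g1 : countGap r 1 1 = countSolid r 1 2 := by
    rw [countGap_step le_rfl (by omega), if_neg, add_zero]
    rw [hs2]; split_ifs <;> omega
  have h0 : countSolid r 1 0 = countSolid r 1 1 + countGap r 1 1 := by
    rw [countSolid_step (by omega), if_pos, if_neg, add_zero]
    all_goals rw [hs1]; split_ifs <;> omega
  have h1 : countSolid r 1 1 = countSolid r 1 2 + countGap r 1 2 +
      if 4 ≤ r then countWideGap r 1 2 else 0 := by
    rw [countSolid_step (by omega), if_pos (by rw [hs2]; split_ifs <;> omega)]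
    congr 2
    rw [hs2]
    apply propext
    split_ifs <;> omega
  have hs3 : slack 1 (2 + 1) = 0 := rfl
  have s2 : countSolid r 1 2 = Nat.fib (r - 1) := by
    conv_lhs => rw [show 2 = r - (r - 2) by omega]
    rw [countSolid_right _ (by omega) (by omega), show r - 2 + 1 = r - 1 by omega]
  have g2 : countGap r 1 2 = countSolid r 1 3 :=
    countGap_step_of_slack_eq_zero hs3 (by omega) hr
  rw [h0, h1, g1, g2, s2, show (r : ℤ) - 1 = ((r - 1 : ℕ) : ℤ) by omega, Int.fib_natCast]
  norm_cast
  obtain rfl | hr3 := hr.eq_or_lt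
  · rw [countSolid_eq_one]; rfl
  have s3 : countSolid r 1 3 = Nat.fib (r - 2) := by
    conv_lhs => rw [show 3 = r - (r - 3) by omega]
    rw [countSolid_right _ (by omega) (by omega), show r - 3 + 1 = r - 2 by omega]
  obtain rfl | hr4 := (show 3 ≤ r from hr3).eq_or_lt
  · rw [s3]; rfl
  have s4 : countSolid r 1 4 = Nat.fib (r - 3) := by
    conv_lhs => rw [show 4 = r - (r - 4) by omega]
    rw [countSolid_right _ (by omega) (by omega), show r - 4 + 1 = r - 3 by omega]
  rw [s3, if_pos (by omega), countWideGap_step le_rfl (by omega),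
    if_pos (by rw [hs3, if_neg (by omega)]; norm_num),
    if_neg (by rw [hs3]; split_ifs <;> omega),
    countGap_step_of_slack_eq_zero rfl (by omega) (by omega), s4,
    show r - 1 = r - 3 + 2 by omega, Nat.fib_add_two, show r - 3 + 1 = r - 2 by omega]
  ring

/-- The penalty for `r` excludes wide gaps, and both solid and gap at `i - 1` have 3 completions
(gap only when `i > 2`), so the left stretch gives `3 (F_{a+1} + F_a)`. -/
theorem countSolid_of_right_end {r i : ℕ} (hi : 2 ≤ i) (hir : i + 1 = r) :
    countSolid r i 0 = 3 * Int.fib (r - 1) := by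
  obtain ⟨a, rfl⟩ : ∃ a, i = a + 2 := ⟨i - 2, by omega⟩
  set i := a + 2 with hia
  have hs1 : slack i (i + 1) = 1 := slack_succ i
  have hs0 : slack i (i - 1 + 1) = 1 := by rw [show i - 1 + 1 = i by omega, slack_self]
  have sr : countSolid r i (i + 1) = 1 := by
    rw [show i + 1 = r - 0 by omega, countSolid_right _ (by omega) (by omega)]
    rfl
  have gr : countGap r i (i + 1) = 1 := by
    rw [countGap_step (by omega) (by omega), if_neg (by omega), add_zero, hir, countSolid_eq_one]
  have s0 : countSolid r i i = 2 := by
    rw [countSolid_step (by omega), if_pos (by rw [hs1]; split_ifs <;> omega), if_neg (by omega),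
      sr, gr]
  have g0 : countGap r i i = 1 := by
    rw [countGap_step (by omega) (by omega), if_neg (by rw [hs1]; split_ifs; omega), sr]
  have d0 : countDeepGap r i i = 1 := by
    rw [countDeepGap_step (by omega) (by omega), sr]
  have sl : countSolid r i (i - 1) = 3 := by
    rw [countSolid_step (by omega), if_pos (by rw [hs0]; split_ifs <;> omega),
      if_neg (by rw [hs0]; split_ifs <;> omega), show i - 1 + 1 = i by omega, s0, g0]
  have gl : Nat.fib a * countGap r i (i - 1) = Nat.fib a * 3 := by
    rcases Nat.eq_zero_or_pos a with ha | ha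
    · rw [ha, Nat.fib_zero, zero_mul, zero_mul]
    · rw [countGap_step (by omega) (by omega), if_pos (by rw [hs0]; split_ifs <;> omega),
        show i - 1 + 1 = i by omega, s0, d0]
  have hleft := countSolid_left (r := r) (i := i) (p := i - 1) a (by omega) (by omega) (by omega)
  rw [show i - 1 - a = 1 by omega, gl, sl] at hleft
  rw [countSolid_zero (by omega) hi, hleft, show (r : ℤ) - 1 = ((a + 2 : ℕ) : ℤ) by omega,
    Int.fib_natCast, Nat.fib_add_two]
  push_cast
  ring

theorem ncard_weylAlternationSet_eq_countSolid {r i : ℕ} (hi : 1 ≤ i) (hir : i + 1 ≤ r) :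
    (weylAlternationSet r (highestRoot r) (-simpleRoot r i - simpleRoot r (i + 1))).ncard =
      countSolid r i 0 := by
  rw [ncard_weylAlternationSet hi hir, ncard_admissiblePerms]
  simp [countSolid]

theorem fib_add_one_add_fib_sub_three (n : ℤ) :
    Int.fib (n + 1) + Int.fib (n - 3) = 3 * Int.fib (n - 1) := by
  have h1 := Int.fib_add_two (n - 1)
  have h2 := Int.fib_add_two (n - 2)
  have h3 := Int.fib_add_two (n - 3)
  ring_nf at h1 h2 h3 ⊢
  linarith

end TypeA

theorem mainTheorem10 (r i : ℕ) :
    (2 ≤ r → (i = 1 ∨ i + 1 = r) →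
      ((TypeA.weylAlternationSet r (TypeA.highestRoot r)
          (-TypeA.simpleRoot r i - TypeA.simpleRoot r (i + 1))).ncard : ℤ)
          = Int.fib ((r : ℤ) + 1) + Int.fib ((r : ℤ) - 3) ∧
      Int.fib ((r : ℤ) + 1) + Int.fib ((r : ℤ) - 3) = 3 * Int.fib ((r : ℤ) - 1)) ∧
    (4 ≤ r → 2 ≤ i → i + 2 ≤ r →
      ((TypeA.weylAlternationSet r (TypeA.highestRoot r)
          (-TypeA.simpleRoot r i - TypeA.simpleRoot r (i + 1))).ncard : ℤ)
          = Int.fib (r : ℤ)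
            + Int.fib ((i : ℤ) - 2) * Int.fib ((r : ℤ) - (i : ℤ))
            + 3 * Int.fib ((i : ℤ) - 1) * Int.fib ((r : ℤ) - (i : ℤ) - 1)
            + Int.fib (i : ℤ) * Int.fib ((r : ℤ) - (i : ℤ) - 2)) := by

  refine ⟨fun hr hi => ⟨?_, TypeA.fib_add_one_add_fib_sub_three r⟩, fun hr hi hir => ?_⟩
  · rw [TypeA.fib_add_one_add_fib_sub_three,
      TypeA.ncard_weylAlternationSet_eq_countSolid (by omega) (by omega)]
    by_cases h : i = 1
    · subst h
      exact TypeA.countSolid_of_left_end hr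
    · exact TypeA.countSolid_of_right_end (by omega) (hi.resolve_left h)
  · rw [TypeA.ncard_weylAlternationSet_eq_countSolid (by omega) (by omega),
      TypeA.countSolid_of_interior hi hir, show (i : ℤ) - 2 = ((i - 2 : ℕ) : ℤ) by omega,
      show (r : ℤ) - i - 1 = ((r - i - 1 : ℕ) : ℤ) by omega,
      show (r : ℤ) - i - 2 = ((r - i - 2 : ℕ) : ℤ) by omega,
      show (r : ℤ) - i = ((r - i : ℕ) : ℤ) by omega,
      show (i : ℤ) - 1 = ((i - 1 : ℕ) : ℤ) by omega]
    simp only [Int.fib_natCast]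
    push_cast
    ring
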